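/- Let $A\in\mathbb{R}^{n\times n}$, $B\in\mathbb{R}^{n\times p}$, $L\in\mathbb{R}^{p\times n}$, and let $X=X^\top=\begin{bmatrix}X^{11}&X^{12}\\X^{21}&X^{22}\end{bmatrix}\in\mathbb{R}^{2n\times 2n}$ have $n\times n$ blocks with $X^{22}<0$ (negative definite). Consider the system $\dot x(t)=(A+BL)x(t)+\eta(t)$ with input $\eta(t)\in\mathbb{R}^n$ and output $y(t)=x(t)\in\mathbb{R}^n$. Every $x^*\in\mathbb{R}^n$ is an equilibrium state of it, for the unique equilibrium input $\eta^*=-(A+BL)x^*$. Let $\mathcal{X}\subseteq\mathbb{R}^n$ be any nonempty set of equilibrium states (e.g. $\mathbb{R}^n$ or $\{0\}$). The system is called $X$-EID (equilibrium-independent dissipative, from $\eta$ to $x$) if there is a continuously differentiable function $V:\mathbb{R}^n\times\mathcal{X}\to\mathbb{R}$ such that, for all $(x,x^*,\eta)\in\mathbb{R}^n\times\mathcal{X}\times\mathbb{R}^n$: $V(x,x^*)>0$ if $x\neq x^*$, $V(x^*,x^*)=0$, and $$\nabla_xV(x,x^*)\big((A+BL)x+\eta\big)\le\begin{bmatrix}\eta-\eta^*\\x-x^*\end{bmatrix}^\top\begin{bmatrix}X^{11}&X^{12}\\X^{21}&X^{22}\end{bmatrix}\begin{bmatrix}\eta-\eta^*\\x-x^*\end{bmatrix}.$$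 Then the system is $X$-EID if and only if there exist a symmetric positive definite $P\in\mathbb{R}^{n\times n}$ and a matrix $K\in\mathbb{R}^{p\times n}$ such that $L=KP^{-1}$ and $$\begin{bmatrix}-(X^{22})^{-1}&P&\mathbf{0}\\P&-\mathcal{H}(AP+BK)&-\mathbf{I}+PX^{21}\\\mathbf{0}&(-\mathbf{I}+PX^{21})^\top&X^{11}\end{bmatrix}\ge 0$$ (symmetric positive semidefinite), where $\mathcal{H}(M)=M+M^\top$. -/

import Mathlib

open Matrix

/-- A dynamic system `ẋ = f(x, u)`, `y = h(x, u)` with state in `ℝⁿ`, input in `ℝ^q`, output in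
`ℝ^m` and continuously differentiable `f`, `h`. -/
structure ControlSystem (n q m : ℕ) where
  f : (Fin n → ℝ) → (Fin q → ℝ) → (Fin n → ℝ)
  h : (Fin n → ℝ) → (Fin q → ℝ) → (Fin m → ℝ)
  contDiff_f : ContDiff ℝ 1 (fun z : (Fin n → ℝ) × (Fin q → ℝ) => f z.1 z.2)
  contDiff_h : ContDiff ℝ 1 (fun z : (Fin n → ℝ) × (Fin q → ℝ) => h z.1 z.2)

/-- `𝒳` is a set of equilibrium states, each with a unique equilibrium input. -/
def ControlSystem.IsEquilibriumSet {n q m : ℕ} (S : ControlSystem n q m)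
    (𝒳 : Set (Fin n → ℝ)) : Prop :=
  ∀ xs ∈ 𝒳, ∃! us : Fin q → ℝ, S.f xs us = 0

/-- Equilibrium-independent dissipativity (EID) under the supply rate `s`, over the equilibrium
set `𝒳`. Here `xs`, `us`, `S.h xs us` are the equilibrium state, input and output. The values of
`V` matter only on `ℝⁿ × 𝒳`. -/
def ControlSystem.IsEID {n q m : ℕ} (S : ControlSystem n q m) (𝒳 : Set (Fin n → ℝ))
    (s : (Fin q → ℝ) → (Fin m → ℝ) → ℝ) : Prop :=
  S.IsEquilibriumSet 𝒳 ∧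
  ∃ V : (Fin n → ℝ) × (Fin n → ℝ) → ℝ,
    ContDiffOn ℝ 1 V (Set.univ ×ˢ 𝒳) ∧
    (∀ x, ∀ xs ∈ 𝒳, x ≠ xs → 0 < V (x, xs)) ∧
    (∀ xs ∈ 𝒳, V (xs, xs) = 0) ∧
    ∀ x, ∀ xs ∈ 𝒳, ∀ u us, S.f xs us = 0 →
      fderiv ℝ (fun z => V (z, xs)) x (S.f x u) ≤ s (u - us) (S.h x u - S.h xs us)

/-- The quadratic supply rate `[u; y]ᵀ X [u; y]`. -/
def quadraticSupply {q m : ℕ} (X : Matrix (Fin q ⊕ Fin m) (Fin q ⊕ Fin m) ℝ)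
    (u : Fin q → ℝ) (y : Fin m → ℝ) : ℝ :=
  Sum.elim u y ⬝ᵥ (X *ᵥ Sum.elim u y)

/-- `X`-EID: EID under the quadratic supply rate with coefficient matrix `X`. -/
def ControlSystem.IsXEID {n q m : ℕ} (S : ControlSystem n q m) (𝒳 : Set (Fin n → ℝ))
    (X : Matrix (Fin q ⊕ Fin m) (Fin q ⊕ Fin m) ℝ) : Prop :=
  S.IsEID 𝒳 (quadraticSupply X)

/-- The system `ẋ = (A + B L) x + η` with input `η` and output `y = x`. -/
def locallyControlledSystem {n p : ℕ} (A : Matrix (Fin n) (Fin n) ℝ)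
    (B : Matrix (Fin n) (Fin p) ℝ) (L : Matrix (Fin p) (Fin n) ℝ) : ControlSystem n n n where
  f x η := (A + B * L) *ᵥ x + η
  h x _ := x
  contDiff_f :=
    (((A + B * L).mulVecLin.toContinuousLinearMap.contDiff).comp contDiff_fst).add contDiff_snd
  contDiff_h := contDiff_fst

/-- `ℋ(M) = M + Mᵀ`. -/
def symPart {n : ℕ} (M : Matrix (Fin n) (Fin n) ℝ) : Matrix (Fin n) (Fin n) ℝ := M + Mᵀ

/-- The symmetric `3 × 3` block matrix
`[-(X²²)⁻¹, P, 0; ⋆, -ℋ(AP + BK), -I + P X²¹; ⋆, ⋆, X¹¹]`. -/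
noncomputable def synthesisMatrix {n p : ℕ} (A : Matrix (Fin n) (Fin n) ℝ)
    (B : Matrix (Fin n) (Fin p) ℝ) (X : Matrix (Fin n ⊕ Fin n) (Fin n ⊕ Fin n) ℝ)
    (P : Matrix (Fin n) (Fin n) ℝ) (K : Matrix (Fin p) (Fin n) ℝ) :
    Matrix (Fin n ⊕ (Fin n ⊕ Fin n)) (Fin n ⊕ (Fin n ⊕ Fin n)) ℝ :=
  fromBlocks (-(X.toBlocks₂₂)⁻¹) (fromCols P 0) (fromCols P 0)ᵀ
    (fromBlocks (-symPart (A * P + B * K)) (-1 + P * X.toBlocks₂₁)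
      (-1 + P * X.toBlocks₂₁)ᵀ X.toBlocks₁₁)

/-! The crux is that an arbitrary C¹ storage function can be replaced by a quadratic one, `zᵀ Q z`;
the rest is a Schur complement with `P = Q⁻¹`. Fix one equilibrium, move it to the origin and write
`ż = M z + v` with storage `f`. By duality, a quadratic storage exists once `tr (X W) ≥ 0` for every
second-moment matrix `W ≥ 0` of `(v, z)` that leaves the state covariance `Z` stationary
(`exists_quadratic_storage`, by Riesz extension). To prove this inequality with `Z > 0`, realise `W`
by a feedback `v = F z` plus a remainder in `v` alone. The remainder costs nothing negative because
`X¹¹ ≥ 0`. Under the feedback the linear flow preserves `Z`, so the sum of `f` over finitely many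
trajectories grows at a rate at most a constant; were that negative, `f ≥ 0` would fail
(`trace_mul_nonneg_of_dissipative`). Singular `Z` follows by perturbation. Finally `X²² < 0` forces
`Q > 0` (`posDef_of_dissipative`). -/

/-! ### Linear flows and stationary covariances -/

theorem false_of_nonneg_of_deriv_le_neg {g g' : ℝ → ℝ} {c : ℝ} (hc : 0 < c)
    (hg : ∀ t, 0 ≤ g t) (hd : ∀ t, HasDerivAt g (g' t) t) (hle : ∀ t, 0 ≤ t → g' t ≤ -c) :
    False := by
  have hd' : ∀ t, HasDerivAt (fun t => g t + c * t) (g' t + c) t := fun t => by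
    have h := (hd t).add ((hasDerivAt_id' t).const_mul c)
    rw [mul_one] at h
    exact h
  have hanti : AntitoneOn (fun t => g t + c * t) (Set.Ici 0) := by
    refine antitoneOn_of_deriv_nonpos (convex_Ici 0)
      (fun t _ => (hd' t).continuousAt.continuousWithinAt)
      (fun t _ => (hd' t).differentiableAt.differentiableWithinAt) fun t ht => ?_
    rw [interior_Ici] at ht
    rw [(hd' t).deriv]
    linarith [hle t (le_of_lt ht)]
  have hT : 0 ≤ g 0 / c + 1 := by have := hg 0; positivity
  have h := hanti (Set.mem_Ici.2 le_rfl) (Set.mem_Ici.2 hT) hT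
  have h1 := hg (g 0 / c + 1)
  have h2 : c * (g 0 / c + 1) = g 0 + c := by field_simp
  simp only [h2] at h
  linarith

theorem hasDerivAt_exp_smul_mulVec {n : ℕ} (G : Matrix (Fin n) (Fin n) ℝ) (z : Fin n → ℝ)
    (t : ℝ) :
    HasDerivAt (fun t : ℝ => NormedSpace.exp (t • G) *ᵥ z)
      (G *ᵥ (NormedSpace.exp (t • G) *ᵥ z)) t := by
  open scoped Norms.Operator in
  have h := hasDerivAt_exp_smul_const' (𝕂 := ℝ) G t
  let l : Matrix (Fin n) (Fin n) ℝ →L[ℝ] (Fin n → ℝ) :=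
    LinearMap.toContinuousLinearMap
      { toFun := fun A => A *ᵥ z
        map_add' := fun A B => add_mulVec A B z
        map_smul' := fun c A => smul_mulVec c A z }
  have h' := l.hasFDerivAt.comp_hasDerivAt t h
  rw [mulVec_mulVec]
  exact h'

/-- The hypothesis says `G = Z (-Gᵀ) Z⁻¹`, so `exp (tG) = Z exp (-tGᵀ) Z⁻¹`, and the last factor
cancels against the transpose. -/
theorem exp_smul_mul_mul_transpose {n : ℕ} {G Z : Matrix (Fin n) (Fin n) ℝ} (hZ : IsUnit Z)
    (h : G * Z + Z * Gᵀ = 0) (t : ℝ) :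
    NormedSpace.exp (t • G) * Z * (NormedSpace.exp (t • G))ᵀ = Z := by
  have hdet := (isUnit_iff_isUnit_det Z).1 hZ
  have hG : t • G = Z * (-(t • Gᵀ)) * Z⁻¹ := by
    have : G = -(Z * Gᵀ) * Z⁻¹ := by
      rw [← eq_neg_of_add_eq_zero_left h, Matrix.mul_nonsing_inv_cancel_right _ _ hdet]
    conv_lhs => rw [this]
    simp
  have h1 : IsUnit (NormedSpace.exp (t • G)ᵀ) := Matrix.isUnit_exp _
  rw [← Matrix.exp_transpose]
  conv_lhs => enter [1, 1]; rw [hG]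
  rw [Matrix.exp_conj _ _ hZ, Matrix.nonsing_inv_mul_cancel_right _ _ hdet, Matrix.exp_neg,
    transpose_smul, Matrix.nonsing_inv_mul_cancel_right]
  exact (isUnit_iff_isUnit_det _).1 h1

theorem trace_mul_transpose_mul_self {m k : Type*} [Fintype m] [Fintype k] (N : Matrix m m ℝ)
    (C : Matrix k m ℝ) : (N * (Cᵀ * C)).trace = ∑ j, C j ⬝ᵥ (N *ᵥ C j) := by
  rw [← Matrix.mul_assoc, Matrix.trace_mul_comm, trace]
  refine Finset.sum_congr rfl fun j _ => ?_
  simp only [diag_apply, Matrix.mul_apply', dotProduct, mulVec, transpose_apply]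

theorem Matrix.PosSemidef.exists_eq_transpose_mul_self {m : Type*} [Fintype m] [DecidableEq m]
    {A : Matrix m m ℝ} (h : A.PosSemidef) : ∃ C : Matrix m m ℝ, A = Cᵀ * C := by
  open scoped MatrixOrder in
  obtain ⟨C, hC⟩ := CStarAlgebra.nonneg_iff_eq_star_mul_self.1 h.nonneg
  exact ⟨C, hC⟩

/-- If `f ≥ 0` grows at rate at most `zᵀ N z` along `ż = G z`, and the flow of `G` preserves the
covariance `Z`, then the mean of the rate over `Z` is nonnegative. -/
theorem trace_mul_nonneg_of_fderiv_le {n : ℕ} {f : (Fin n → ℝ) → ℝ} (hf : Differentiable ℝ f)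
    (hf0 : ∀ z, 0 ≤ f z) {N G Z : Matrix (Fin n) (Fin n) ℝ}
    (hd : ∀ z, fderiv ℝ f z (G *ᵥ z) ≤ z ⬝ᵥ (N *ᵥ z)) (hZ : Z.PosDef)
    (hG : G * Z + Z * Gᵀ = 0) : 0 ≤ (N * Z).trace := by
  by_contra! hneg
  obtain ⟨C, hC⟩ := hZ.posSemidef.exists_eq_transpose_mul_self
  -- The rows of `C` are initial states whose outer products sum to `Z`; the flow keeps that sum, so
  -- the total rate is constant in time.
  let φ : Fin n → ℝ → Fin n → ℝ := fun j t => NormedSpace.exp (t • G) *ᵥ C j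
  refine false_of_nonneg_of_deriv_le_neg (g := fun t => ∑ j, f (φ j t))
    (g' := fun t => ∑ j, fderiv ℝ f (φ j t) (G *ᵥ φ j t)) (neg_pos.2 hneg)
    (fun t => Finset.sum_nonneg fun j _ => hf0 _)
    (fun t => HasDerivAt.fun_sum fun j _ =>
      (hf _).hasFDerivAt.comp_hasDerivAt t (hasDerivAt_exp_smul_mulVec G (C j) t)) fun t _ => ?_
  rw [neg_neg]
  calc ∑ j, fderiv ℝ f (φ j t) (G *ᵥ φ j t) ≤ ∑ j, φ j t ⬝ᵥ (N *ᵥ φ j t) :=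
        Finset.sum_le_sum fun j _ => hd _
    _ = (N * Z).trace := by
        have hφ : ∀ j, φ j t = (C * (NormedSpace.exp (t • G))ᵀ) j := fun j => by
          rw [Matrix.mul_apply_eq_vecMul, Matrix.vecMul_transpose]
        simp_rw [hφ]
        rw [← trace_mul_transpose_mul_self, transpose_mul, transpose_transpose]
        conv_rhs => rw [← exp_smul_mul_mul_transpose hZ.isUnit hG t, hC]
        simp only [Matrix.mul_assoc]

/-! ### Supply rate and stationary second moments -/

theorem quadraticSupply_eq_trace {q m : ℕ} (X : Matrix (Fin q ⊕ Fin m) (Fin q ⊕ Fin m) ℝ)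
    (u : Fin q → ℝ) (y : Fin m → ℝ) :
    quadraticSupply X u y = (X * vecMulVec (Sum.elim u y) (Sum.elim u y)).trace := by
  rw [quadraticSupply, mul_vecMulVec, trace_vecMulVec, dotProduct_comm]

theorem quadraticSupply_mulVec {q m : ℕ} (X : Matrix (Fin q ⊕ Fin m) (Fin q ⊕ Fin m) ℝ)
    (F : Matrix (Fin q) (Fin m) ℝ) (y : Fin m → ℝ) :
    quadraticSupply X (F *ᵥ y) y =
      y ⬝ᵥ (((fromRows F (1 : Matrix (Fin m) (Fin m) ℝ))ᵀ * X *
        fromRows F (1 : Matrix (Fin m) (Fin m) ℝ)) *ᵥ y) := by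
  have h : Sum.elim (F *ᵥ y) y = fromRows F 1 *ᵥ y := by rw [fromRows_mulVec, one_mulVec]
  rw [quadraticSupply, h, ← mulVec_mulVec, ← mulVec_mulVec, dotProduct_mulVec y,
    vecMul_transpose]

theorem quadraticSupply_eq {q m : ℕ} {X : Matrix (Fin q ⊕ Fin m) (Fin q ⊕ Fin m) ℝ}
    (hX : X.IsSymm) (u : Fin q → ℝ) (y : Fin m → ℝ) :
    quadraticSupply X u y = u ⬝ᵥ (X.toBlocks₁₁ *ᵥ u) + 2 * (y ⬝ᵥ (X.toBlocks₂₁ *ᵥ u)) +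
      y ⬝ᵥ (X.toBlocks₂₂ *ᵥ y) := by
  have h12 : X.toBlocks₁₂ = X.toBlocks₂₁ᵀ := by
    ext i j; exact (hX.apply (Sum.inl i) (Sum.inr j)).symm
  have h : u ⬝ᵥ (X.toBlocks₁₂ *ᵥ y) = y ⬝ᵥ (X.toBlocks₂₁ *ᵥ u) := by
    rw [h12, mulVec_transpose, dotProduct_comm, ← dotProduct_mulVec]
  conv_lhs => rw [quadraticSupply, ← fromBlocks_toBlocks X, fromBlocks_mulVec]
  simp only [sumElim_dotProduct_sumElim, dotProduct_add, Sum.elim_comp_inl, Sum.elim_comp_inr, h]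
  ring

theorem trace_mul_nonneg_of_dissipative {n : ℕ} {f : (Fin n → ℝ) → ℝ} (hf : Differentiable ℝ f)
    (hf0 : ∀ z, 0 ≤ f z) {M : Matrix (Fin n) (Fin n) ℝ}
    {X : Matrix (Fin n ⊕ Fin n) (Fin n ⊕ Fin n) ℝ}
    (hd : ∀ z v, fderiv ℝ f z (M *ᵥ z + v) ≤ quadraticSupply X v z)
    (hX11 : ∀ v, 0 ≤ quadraticSupply X v 0)
    {W : Matrix (Fin n ⊕ Fin n) (Fin n ⊕ Fin n) ℝ} (hW : W.PosSemidef)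
    (hZ : W.toBlocks₂₂.PosDef)
    (hl : M * W.toBlocks₂₂ + W.toBlocks₁₂ + (M * W.toBlocks₂₂ + W.toBlocks₁₂)ᵀ = 0) :
    0 ≤ (X * W).trace := by
  set Z := W.toBlocks₂₂ with hZdef
  set H := W.toBlocks₁₂ with hHdef
  have hZs : Zᵀ = Z := hZ.isHermitian
  have hdet := (isUnit_iff_isUnit_det Z).1 hZ.isUnit
  have hHt : W.toBlocks₂₁ = Hᵀ := by
    ext i j; exact (hW.isHermitian.apply (Sum.inr i) (Sum.inl j)).symm
  have hWb : W = fromBlocks W.toBlocks₁₁ H Hᴴ Z := by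
    conv_lhs => rw [← fromBlocks_toBlocks W, hHt]
    rfl
  have := hZ.isUnit.invertible
  have hN := hW
  rw [hWb, PosDef.fromBlocks₂₂ _ _ hZ] at hN
  -- `F` is the regression of the input on the state, and the Schur complement is the residual input
  -- covariance.
  obtain ⟨F, hF⟩ : ∃ F, F = H * Z⁻¹ := ⟨_, rfl⟩
  rw [← hF] at hN
  have hFZ : F * Z = H := hF ▸ Matrix.nonsing_inv_mul_cancel_right _ _ hdet
  have hZF : Z * Fᵀ = Hᵀ := by rw [← hFZ, transpose_mul, hZs]
  obtain ⟨J, hJ⟩ : ∃ J, J = fromRows F (1 : Matrix (Fin n) (Fin n) ℝ) := ⟨_, rfl⟩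
  obtain ⟨C, hC⟩ := hN.exists_eq_transpose_mul_self
  have hU : W.toBlocks₁₁ = Cᵀ * C + H * Fᵀ := by
    have h : F * Hᴴ = H * Fᵀ := by
      rw [conjTranspose_eq_transpose_of_trivial, ← hZF, ← Matrix.mul_assoc, hFZ]
    rw [← hC, h, sub_add_cancel]
  have hsplit : W = (fromCols C 0)ᵀ * fromCols C (0 : Matrix (Fin n) (Fin n) ℝ) +
      J * Z * (J)ᵀ := by
    rw [hWb, hU, hJ, transpose_fromCols, transpose_fromRows, fromRows_mul_fromCols, fromRows_mul,
      fromRows_mul_fromCols, fromBlocks_add]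
    simp only [transpose_zero, transpose_one, Matrix.mul_zero, Matrix.zero_mul, Matrix.one_mul,
      Matrix.mul_one, zero_add, hFZ, hZF]
    rfl
  rw [hsplit, Matrix.mul_add, trace_add, trace_mul_transpose_mul_self]
  refine add_nonneg (Finset.sum_nonneg fun j _ => ?_) ?_
  · have h : fromCols C (0 : Matrix (Fin n) (Fin n) ℝ) j = Sum.elim (C j) 0 := by
      ext (i | i) <;> rfl
    rw [h]
    exact hX11 _
  · have h : (X * (J * Z * (J)ᵀ)).trace =
        ((J)ᵀ * X * J * Z).trace := by
      rw [← Matrix.mul_assoc, trace_mul_comm]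
      simp only [Matrix.mul_assoc]
    rw [h]
    refine trace_mul_nonneg_of_fderiv_le hf hf0 (G := M + F) (fun z => ?_) hZ ?_
    · rw [hJ, ← quadraticSupply_mulVec, add_mulVec]
      exact hd _ _
    · rw [← hl, transpose_add, transpose_add, Matrix.add_mul, Matrix.mul_add, hFZ, hZF,
        transpose_mul, hZs]

/-! ### Duality: from any storage function to a quadratic one -/

/-- Pairs `(Y, t)` such that some second-moment matrix `W` of inputs and states has supply at most
`t` and changes the covariance of the states of `ż = M z + v` at the rate `Y + Yᵀ`. -/
def supplyCone {n : ℕ} (M : Matrix (Fin n) (Fin n) ℝ)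
    (X : Matrix (Fin n ⊕ Fin n) (Fin n ⊕ Fin n) ℝ) :
    PointedCone ℝ (Matrix (Fin n) (Fin n) ℝ × ℝ) where
  carrier := {q | ∃ W : Matrix (Fin n ⊕ Fin n) (Fin n ⊕ Fin n) ℝ, W.PosSemidef ∧
    q.1 + q.1ᵀ = M * W.toBlocks₂₂ + W.toBlocks₁₂ + (M * W.toBlocks₂₂ + W.toBlocks₁₂)ᵀ ∧
    (X * W).trace ≤ q.2}
  add_mem' := by
    rintro ⟨Y, t⟩ ⟨Y', t'⟩ ⟨W, hW, h1, h2⟩ ⟨W', hW', h1', h2'⟩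
    refine ⟨W + W', hW.add hW', ?_, ?_⟩
    · have e1 : (W + W').toBlocks₂₂ = W.toBlocks₂₂ + W'.toBlocks₂₂ := rfl
      have e2 : (W + W').toBlocks₁₂ = W.toBlocks₁₂ + W'.toBlocks₁₂ := rfl
      have h := congrArg₂ (· + ·) h1 h1'
      simp only [e1, e2, Prod.mk_add_mk, transpose_add, Matrix.mul_add] at h ⊢
      convert h using 1 <;> abel
    · simpa [Matrix.mul_add] using add_le_add h2 h2'
  zero_mem' := ⟨0, PosSemidef.zero, by
    have e1 : (0 : Matrix (Fin n ⊕ Fin n) (Fin n ⊕ Fin n) ℝ).toBlocks₂₂ = 0 := rfl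
    have e2 : (0 : Matrix (Fin n ⊕ Fin n) (Fin n ⊕ Fin n) ℝ).toBlocks₁₂ = 0 := rfl
    simp [e1, e2], by simp⟩
  smul_mem' := by
    rintro ⟨c, hc⟩ ⟨Y, t⟩ ⟨W, hW, h1, h2⟩
    refine ⟨c • W, hW.smul hc, ?_, ?_⟩
    · have e1 : (c • W).toBlocks₂₂ = c • W.toBlocks₂₂ := rfl
      have e2 : (c • W).toBlocks₁₂ = c • W.toBlocks₁₂ := rfl
      have h := congrArg (c • ·) h1
      simp only [smul_add] at h
      simp only [e1, e2, Matrix.mul_smul, transpose_add, transpose_smul]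
      change c • Y + (c • Y)ᵀ = _
      rw [transpose_smul, h, transpose_add, smul_add]
    · change _ ≤ c * t
      rw [Matrix.mul_smul, trace_smul, smul_eq_mul]
      exact mul_le_mul_of_nonneg_left h2 hc

theorem fromRows_mul_transpose {n : ℕ} (H : Matrix (Fin n) (Fin n) ℝ) :
    fromRows H (1 : Matrix (Fin n) (Fin n) ℝ) * (fromRows H (1 : Matrix (Fin n) (Fin n) ℝ))ᵀ =
      fromBlocks (H * Hᵀ) H Hᵀ 1 := by
  rw [transpose_fromRows, fromRows_mul_fromCols]
  simp

theorem nonneg_of_mem_supplyCone {n : ℕ} {f : (Fin n → ℝ) → ℝ} (hf : Differentiable ℝ f)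
    (hf0 : ∀ z, 0 ≤ f z) {M : Matrix (Fin n) (Fin n) ℝ}
    {X : Matrix (Fin n ⊕ Fin n) (Fin n ⊕ Fin n) ℝ}
    (hd : ∀ z v, fderiv ℝ f z (M *ᵥ z + v) ≤ quadraticSupply X v z)
    (hX11 : ∀ v, 0 ≤ quadraticSupply X v 0) {t : ℝ} (h : (0, t) ∈ supplyCone M X) : 0 ≤ t := by
  obtain ⟨W, hW, h1, h2⟩ := h
  -- Moments of the feedback `v = -M z` with identity covariance: the closed loop is at rest, so
  -- adding `ε W₀` keeps stationarity and makes the state block definite.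
  obtain ⟨W₀, hW₀⟩ : ∃ W₀, W₀ = fromBlocks (-M * (-M)ᵀ) (-M) (-M)ᵀ 1 := ⟨_, rfl⟩
  have hW₀p : W₀.PosSemidef := by
    rw [hW₀, ← fromRows_mul_transpose]
    exact posSemidef_self_mul_conjTranspose _
  have key : ∀ ε : ℝ, 0 < ε → 0 ≤ (X * W).trace + ε * (X * W₀).trace := fun ε hε => by
    have e1 : (W + ε • W₀).toBlocks₂₂ = W.toBlocks₂₂ + ε • 1 := by rw [hW₀]; rfl
    have e2 : (W + ε • W₀).toBlocks₁₂ = W.toBlocks₁₂ + ε • -M := by rw [hW₀]; rfl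
    have h := trace_mul_nonneg_of_dissipative hf hf0 hd hX11 (W := W + ε • W₀)
      (hW.add (hW₀p.smul hε.le)) ?_ ?_
    · simpa [Matrix.mul_add] using h
    · rw [e1]
      exact PosDef.posSemidef_add (hW.submatrix Sum.inr) (PosDef.one.smul hε)
    · have e3 : M * (W.toBlocks₂₂ + ε • 1) + (W.toBlocks₁₂ + ε • -M) =
          M * W.toBlocks₂₂ + W.toBlocks₁₂ := by
        rw [Matrix.mul_add, Matrix.mul_smul, Matrix.mul_one, smul_neg]; abel
      rw [e1, e2, e3, ← h1]
      simp
  refine le_trans ?_ h2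
  refine ge_of_tendsto (f := fun ε : ℝ => (X * W).trace + ε * (X * W₀).trace)
    (x := nhdsWithin 0 (Set.Ioi 0)) ?_
    (Filter.eventually_of_mem self_mem_nhdsWithin fun ε hε => key ε hε)
  refine tendsto_nhdsWithin_of_tendsto_nhds ?_
  have : Continuous fun ε : ℝ => (X * W).trace + ε * (X * W₀).trace := by fun_prop
  simpa using this.tendsto 0

theorem exists_quadratic_storage {n : ℕ} {f : (Fin n → ℝ) → ℝ} (hf : Differentiable ℝ f)
    (hf0 : ∀ z, 0 ≤ f z) {M : Matrix (Fin n) (Fin n) ℝ}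
    {X : Matrix (Fin n ⊕ Fin n) (Fin n ⊕ Fin n) ℝ}
    (hd : ∀ z v, fderiv ℝ f z (M *ᵥ z + v) ≤ quadraticSupply X v z)
    (hX11 : ∀ v, 0 ≤ quadraticSupply X v 0) :
    ∃ Q : Matrix (Fin n) (Fin n) ℝ, Qᵀ = Q ∧
      ∀ z v, 2 * (z ⬝ᵥ (Q *ᵥ (M *ᵥ z + v))) ≤ quadraticSupply X v z := by
  -- The functional `(0, t) ↦ t`, to be extended nonnegatively on the cone.
  let F : (Matrix (Fin n) (Fin n) ℝ × ℝ) →ₗ.[ℝ] ℝ :=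
    ⟨LinearMap.ker (LinearMap.fst ℝ (Matrix (Fin n) (Fin n) ℝ) ℝ),
      (LinearMap.snd ℝ (Matrix (Fin n) (Fin n) ℝ) ℝ).domRestrict _⟩
  obtain ⟨g, hgF, hg⟩ := riesz_extension (supplyCone M X) F (by
      rintro ⟨⟨Y, t⟩, hY⟩ hx
      obtain rfl : Y = 0 := hY
      exact nonneg_of_mem_supplyCone hf hf0 hd hX11 hx) (by
      rintro ⟨Y, t⟩
      -- The feedback `v = (Y - M) z` with identity covariance gives exactly the drift `Y`.
      obtain ⟨W, hW⟩ : ∃ W, W = fromBlocks ((Y - M) * (Y - M)ᵀ) (Y - M) (Y - M)ᵀ 1 := ⟨_, rfl⟩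
      refine ⟨⟨(0, (X * W).trace - t), rfl⟩, W, ?_, ?_, ?_⟩
      · rw [hW, ← fromRows_mul_transpose]
        exact posSemidef_self_mul_conjTranspose _
      · have e1 : W.toBlocks₂₂ = 1 := by rw [hW]; rfl
        have e2 : W.toBlocks₁₂ = Y - M := by rw [hW]; rfl
        simp [e1, e2]
      · simp)
  have hg1 : ∀ t : ℝ, g (0, t) = t := fun t => hgF ⟨(0, t), rfl⟩
  have hsymm : ∀ i j, g (single i j 1, 0) ≤ g (single j i 1, 0) := fun i j => by
    -- The cone sees only `Y + Yᵀ`, so it contains all skew `Y` paired with `0`.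
    have h : (single j i (1 : ℝ) - single i j 1, (0 : ℝ)) ∈ supplyCone M X := by
      obtain ⟨W, hW, h1, h2⟩ := (supplyCone M X).zero_mem
      refine ⟨W, hW, ?_, h2⟩
      rw [← h1]
      simp
    have h' := hg _ h
    have e : (single j i (1 : ℝ) - single i j 1, (0 : ℝ)) =
      (single j i (1 : ℝ), (0 : ℝ)) - (single i j (1 : ℝ), (0 : ℝ)) := by simp
    rw [e, map_sub] at h'
    linarith
  let Q : Matrix (Fin n) (Fin n) ℝ := of fun i j => -(1 / 2) * g (single i j 1, 0)
  have hQ : Qᵀ = Q := by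
    ext i j
    simp only [transpose_apply, Q, of_apply, le_antisymm (hsymm i j) (hsymm j i)]
  refine ⟨Q, hQ, fun z v => ?_⟩
  have hgQ : ∀ Y : Matrix (Fin n) (Fin n) ℝ, g (Y, 0) = -2 * ∑ i, ∑ j, Y i j * Q i j := fun Y => by
    have h : (g ∘ₗ LinearMap.inl ℝ _ ℝ) Y = -2 * ∑ i, ∑ j, Y i j * Q i j := by
      conv_lhs => rw [matrix_eq_sum_single Y]
      rw [map_sum, Finset.mul_sum]
      refine Finset.sum_congr rfl fun i _ => ?_
      rw [map_sum, Finset.mul_sum]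
      refine Finset.sum_congr rfl fun j _ => ?_
      have e : single i j (Y i j) = Y i j • single i j (1 : ℝ) := by simp [smul_single]
      rw [e, map_smul]
      simp only [LinearMap.comp_apply, LinearMap.inl_apply, Q, of_apply, smul_eq_mul]
      ring
    exact h
  -- Rank-one moments turn nonnegativity of `g` into the pointwise dissipation inequality.
  have hmem : (vecMulVec z (M *ᵥ z + v), quadraticSupply X v z) ∈ supplyCone M X := by
    refine ⟨vecMulVec (Sum.elim v z) (Sum.elim v z), ?_, ?_, (quadraticSupply_eq_trace X v z).ge⟩
    · exact posSemidef_vecMulVec_self_star _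
    · have e1 : (vecMulVec (Sum.elim v z) (Sum.elim v z)).toBlocks₂₂ = vecMulVec z z := rfl
      have e2 : (vecMulVec (Sum.elim v z) (Sum.elim v z)).toBlocks₁₂ = vecMulVec v z := rfl
      rw [e1, e2, mul_vecMulVec, ← add_vecMulVec, transpose_vecMulVec, transpose_vecMulVec,
        add_comm]
  have h := hg _ hmem
  have e : (vecMulVec z (M *ᵥ z + v), quadraticSupply X v z) =
    (vecMulVec z (M *ᵥ z + v), (0 : ℝ)) + (0, quadraticSupply X v z) := by simp
  have e' : z ⬝ᵥ (Q *ᵥ (M *ᵥ z + v)) = ∑ i, ∑ j, vecMulVec z (M *ᵥ z + v) i j * Q i j := by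
    simp only [dotProduct, mulVec, Finset.mul_sum, vecMulVec_apply]
    exact Finset.sum_congr rfl fun i _ => Finset.sum_congr rfl fun j _ => by ring
  rw [e, map_add, hg1, hgQ] at h
  rw [e']
  linarith

/-! ### Positive definiteness of the quadratic storage -/

/-- The ratio of the two forms is bounded on the compact unit sphere and invariant under scaling. -/
theorem Matrix.PosDef.exists_pos_mul_le {n : ℕ} {N : Matrix (Fin n) (Fin n) ℝ} (hN : N.PosDef)
    (Q : Matrix (Fin n) (Fin n) ℝ) :
    ∃ κ : ℝ, 0 < κ ∧ ∀ z, κ * (z ⬝ᵥ (Q *ᵥ z)) ≤ z ⬝ᵥ (N *ᵥ z) := by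
  have hpos : ∀ z, z ≠ 0 → 0 < z ⬝ᵥ (N *ᵥ z) := fun z hz => by
    simpa using hN.dotProduct_mulVec_pos hz
  have hcont : ∀ A : Matrix (Fin n) (Fin n) ℝ, Continuous fun z => z ⬝ᵥ (A *ᵥ z) := fun A =>
    Continuous.dotProduct continuous_id (continuous_const.matrix_mulVec continuous_id)
  obtain ⟨C, hC⟩ := (isCompact_sphere (0 : Fin n → ℝ) 1).exists_bound_of_continuousOn
    (f := fun z => z ⬝ᵥ (Q *ᵥ z) / z ⬝ᵥ (N *ᵥ z))
    ((hcont Q).continuousOn.div (hcont N).continuousOn fun z hz =>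
      (hpos z (ne_zero_of_mem_unit_sphere ⟨z, hz⟩)).ne')
  have hκ : 0 < |C| + 1 := by positivity
  refine ⟨(|C| + 1)⁻¹, inv_pos.2 hκ, fun z => ?_⟩
  rcases eq_or_ne z 0 with rfl | hz
  · simp
  · have hn : 0 < ‖z‖ := norm_pos_iff.2 hz
    have h := hC (‖z‖⁻¹ • z) (by simp [norm_smul, hn.ne'])
    simp only [mulVec_smul, smul_dotProduct, dotProduct_smul, smul_eq_mul] at h
    rw [mul_div_mul_left _ _ (inv_pos.2 hn).ne', mul_div_mul_left _ _ (inv_pos.2 hn).ne'] at h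
    have h2 := (div_le_iff₀ (hpos z hz)).1 ((le_abs_self _).trans h)
    rw [inv_mul_le_iff₀ hκ]
    exact h2.trans (mul_le_mul_of_nonneg_right (by linarith [le_abs_self C]) (hpos z hz).le)

theorem dotProduct_mulVec_comm_of_transpose_eq {n : ℕ} {Q : Matrix (Fin n) (Fin n) ℝ}
    (hQ : Qᵀ = Q) (x y : Fin n → ℝ) : x ⬝ᵥ (Q *ᵥ y) = y ⬝ᵥ (Q *ᵥ x) := by
  rw [dotProduct_mulVec, ← mulVec_transpose, hQ, dotProduct_comm]

theorem quadraticSupply_zero_left {q m : ℕ} (X : Matrix (Fin q ⊕ Fin m) (Fin q ⊕ Fin m) ℝ)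
    (y : Fin m → ℝ) : quadraticSupply X 0 y = y ⬝ᵥ (X.toBlocks₂₂ *ᵥ y) := by
  conv_lhs => rw [quadraticSupply, ← fromBlocks_toBlocks X, fromBlocks_mulVec]
  simp [sumElim_dotProduct_sumElim]

theorem posDef_of_dissipative {n : ℕ} {f : (Fin n → ℝ) → ℝ} (hf : Differentiable ℝ f)
    (hf0 : ∀ z, 0 ≤ f z) {M : Matrix (Fin n) (Fin n) ℝ}
    {X : Matrix (Fin n ⊕ Fin n) (Fin n ⊕ Fin n) ℝ} (hX22 : (-X.toBlocks₂₂).PosDef)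
    (hd : ∀ z v, fderiv ℝ f z (M *ᵥ z + v) ≤ quadraticSupply X v z)
    {Q : Matrix (Fin n) (Fin n) ℝ} (hQ : Qᵀ = Q)
    (hQd : ∀ z v, 2 * (z ⬝ᵥ (Q *ᵥ (M *ᵥ z + v))) ≤ quadraticSupply X v z) : Q.PosDef := by
  have hQd' : ∀ z, 2 * (z ⬝ᵥ (Q *ᵥ (M *ᵥ z))) ≤ z ⬝ᵥ (X.toBlocks₂₂ *ᵥ z) := fun z => by
    simpa [quadraticSupply_zero_left] using hQd z 0
  have hd' : ∀ z, fderiv ℝ f z (M *ᵥ z) ≤ z ⬝ᵥ (X.toBlocks₂₂ *ᵥ z) := fun z => by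
    simpa [quadraticSupply_zero_left] using hd z 0
  have hneg : ∀ z, z ≠ 0 → z ⬝ᵥ (X.toBlocks₂₂ *ᵥ z) < 0 := fun z hz => by
    simpa [neg_mulVec] using hX22.dotProduct_mulVec_pos hz
  have hnonpos : ∀ z, z ⬝ᵥ (X.toBlocks₂₂ *ᵥ z) ≤ 0 := fun z => by
    rcases eq_or_ne z 0 with rfl | hz
    · simp
    · exact (hneg z hz).le
  have hpsd : Q.PosSemidef := by
    refine PosSemidef.of_dotProduct_mulVec_nonneg hQ fun z => ?_
    rw [star_trivial]
    by_contra! hz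
    -- Along `ż = M z` the form of `Q` decreases, so it stays below its negative initial value.
    -- Through `κ` this keeps the supply below a negative constant, which `f ≥ 0` forbids.
    obtain ⟨κ, hκ, hle⟩ := hX22.exists_pos_mul_le (-Q)
    let φ : ℝ → Fin n → ℝ := fun t => NormedSpace.exp (t • M) *ᵥ z
    have hφ : ∀ t, HasDerivAt φ (M *ᵥ φ t) t := hasDerivAt_exp_smul_mulVec M z
    have hφ0 : φ 0 = z := by simp [φ]
    have hq : ∀ t, HasDerivAt (fun t => φ t ⬝ᵥ (Q *ᵥ φ t)) (2 * (φ t ⬝ᵥ (Q *ᵥ (M *ᵥ φ t)))) t := by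
      intro t
      have h1 : HasDerivAt (fun t => Q *ᵥ φ t) (Q *ᵥ (M *ᵥ φ t)) t :=
        (Q.mulVecLin.toContinuousLinearMap.hasFDerivAt).comp_hasDerivAt t (hφ t)
      have h2 : HasDerivAt (fun t => φ t ⬝ᵥ (Q *ᵥ φ t))
          (∑ i, ((M *ᵥ φ t) i * (Q *ᵥ φ t) i + φ t i * (Q *ᵥ (M *ᵥ φ t)) i)) t :=
        HasDerivAt.fun_sum fun i _ => (hasDerivAt_pi.1 (hφ t) i).mul (hasDerivAt_pi.1 h1 i)
      convert h2 using 1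
      rw [Finset.sum_add_distrib, two_mul]
      congr 1
      exact dotProduct_mulVec_comm_of_transpose_eq hQ _ _
    have hanti : Antitone fun t => φ t ⬝ᵥ (Q *ᵥ φ t) :=
      antitone_of_deriv_nonpos (fun t => (hq t).differentiableAt) fun t => by
        rw [(hq t).deriv]
        exact (hQd' _).trans (hnonpos _)
    refine false_of_nonneg_of_deriv_le_neg (g := fun t => f (φ t))
      (g' := fun t => fderiv ℝ f (φ t) (M *ᵥ φ t)) (c := κ * -(z ⬝ᵥ (Q *ᵥ z)))
      (mul_pos hκ (neg_pos.2 hz)) (fun t => hf0 _)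
      (fun t => (hf _).hasFDerivAt.comp_hasDerivAt t (hφ t)) fun t ht => ?_
    have h1 := hle (φ t)
    have h2 := hanti ht
    simp only [hφ0] at h2
    simp only [neg_mulVec, dotProduct_neg] at h1
    have h3 := mul_le_mul_of_nonneg_left h2 hκ.le
    linarith [hd' (φ t)]
  refine PosDef.of_dotProduct_mulVec_pos hQ fun z hz => ?_
  refine (hpsd.dotProduct_mulVec_nonneg z).lt_of_ne' fun h => ?_
  have h0 := (hpsd.dotProduct_mulVec_zero_iff z).1 h
  have h1 := hQd' z
  rw [dotProduct_mulVec_comm_of_transpose_eq hQ, h0, dotProduct_zero, mul_zero] at h1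
  exact (hneg z hz).not_ge h1

/-! ### The matrix inequality as a dissipation inequality -/

/-- The Schur complement of the block `-(X²²)⁻¹`, under the substitution `z = P u`, is supply minus
storage rate. -/
theorem synthesisMatrix_posSemidef_iff {n p : ℕ} {A : Matrix (Fin n) (Fin n) ℝ}
    {B : Matrix (Fin n) (Fin p) ℝ} {X : Matrix (Fin n ⊕ Fin n) (Fin n ⊕ Fin n) ℝ}
    (hX : X.IsSymm) (hX22 : (-X.toBlocks₂₂).PosDef) {P : Matrix (Fin n) (Fin n) ℝ}
    (hP : P.PosDef) (K : Matrix (Fin p) (Fin n) ℝ) :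
    (synthesisMatrix A B X P K).PosSemidef ↔
      ∀ z v, 2 * (z ⬝ᵥ (P⁻¹ *ᵥ ((A + B * (K * P⁻¹)) *ᵥ z + v))) ≤ quadraticSupply X v z := by
  have hPs : Pᵀ = P := hP.isHermitian
  have hPdet := (isUnit_iff_isUnit_det P).1 hP.isUnit
  have h22 : IsUnit X.toBlocks₂₂.det := by
    have h := (isUnit_iff_isUnit_det _).1 hX22.isUnit.neg
    rwa [neg_neg] at h
  have hinv : (-X.toBlocks₂₂)⁻¹ = -(X.toBlocks₂₂)⁻¹ :=
    Matrix.inv_eq_left_inv (by rw [neg_mul_neg, nonsing_inv_mul _ h22])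
  have hA0 : (-(X.toBlocks₂₂)⁻¹).PosDef := hinv ▸ hX22.inv
  have := hA0.isUnit.invertible
  have hA0i : (-(X.toBlocks₂₂)⁻¹)⁻¹ = -X.toBlocks₂₂ := by
    rw [← hinv, nonsing_inv_nonsing_inv _ ((isUnit_iff_isUnit_det _).1 hX22.isUnit)]
  have hX11s : X.toBlocks₁₁ᵀ = X.toBlocks₁₁ := by
    ext i j; exact hX.apply (Sum.inl i) (Sum.inl j)
  have hsymm : ∀ N : Matrix (Fin n) (Fin n) ℝ, (symPart N)ᵀ = symPart N := fun N => by
    rw [symPart, transpose_add, transpose_transpose, add_comm]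
  have hform : ∀ u v : Fin n → ℝ,
      Sum.elim u v ⬝ᵥ ((fromBlocks (-symPart (A * P + B * K)) (-1 + P * X.toBlocks₂₁)
        (-1 + P * X.toBlocks₂₁)ᵀ X.toBlocks₁₁ -
        (fromCols P (0 : Matrix (Fin n) (Fin n) ℝ))ᴴ * (-(X.toBlocks₂₂)⁻¹)⁻¹ *
          fromCols P (0 : Matrix (Fin n) (Fin n) ℝ)) *ᵥ Sum.elim u v) =
      quadraticSupply X v (P *ᵥ u) -
        2 * ((P *ᵥ u) ⬝ᵥ (P⁻¹ *ᵥ ((A + B * (K * P⁻¹)) *ᵥ (P *ᵥ u) + v))) := fun u v => by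
    have hT : ∀ (N : Matrix (Fin n) (Fin n) ℝ) (x y : Fin n → ℝ),
        x ⬝ᵥ (Nᵀ *ᵥ y) = y ⬝ᵥ (N *ᵥ x) := fun N x y => by
      rw [mulVec_transpose, dotProduct_comm, ← dotProduct_mulVec]
    have hPu : ∀ w, (P *ᵥ u) ⬝ᵥ w = u ⬝ᵥ (P *ᵥ w) := fun w => by
      rw [← hT, dotProduct_comm, hPs]
    have hM : (A + B * (K * P⁻¹)) * P = A * P + B * K := by
      rw [Matrix.add_mul, Matrix.mul_assoc B, nonsing_inv_mul_cancel_right _ _ hPdet]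
    rw [hA0i, conjTranspose_eq_transpose_of_trivial, transpose_fromCols, hPs, sub_mulVec,
      dotProduct_sub, fromBlocks_mulVec, ← mulVec_mulVec, ← mulVec_mulVec, fromCols_mulVec,
      fromRows_mulVec, quadraticSupply_eq hX, mulVec_mulVec _ (A + B * (K * P⁻¹)) P, hM]
    generalize A * P + B * K = N
    simp only [sumElim_dotProduct_sumElim, Sum.elim_comp_inl, Sum.elim_comp_inr, zero_mulVec,
      dotProduct_zero, add_zero, neg_mulVec, transpose_zero, mulVec_neg, Matrix.zero_mul,
      Matrix.neg_mul, dotProduct_neg, add_mulVec, mulVec_add,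
      dotProduct_add, symPart, hPu, hT, one_mulVec, mulVec_mulVec,
      ← Matrix.mul_assoc, mul_nonsing_inv _ hPdet, Matrix.one_mul, mul_add]
    ring
  rw [synthesisMatrix, ← conjTranspose_eq_transpose_of_trivial (fromCols P 0),
    PosDef.fromBlocks₁₁ _ _ hA0]
  constructor
  · intro h z v
    have h1 := h.dotProduct_mulVec_nonneg (Sum.elim (P⁻¹ *ᵥ z) v)
    rw [star_trivial, hform, mulVec_mulVec, mul_nonsing_inv _ hPdet, one_mulVec] at h1
    linarith
  · intro h
    refine PosSemidef.of_dotProduct_mulVec_nonneg ?_ fun w => ?_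
    · refine IsHermitian.sub ?_ (isHermitian_conjTranspose_mul_mul _ hA0.inv.isHermitian)
      rw [IsHermitian, conjTranspose_eq_transpose_of_trivial, fromBlocks_transpose]
      simp [hsymm, hX11s]
    · rw [star_trivial, ← Sum.elim_comp_inl_inr w, hform]
      linarith [h (P *ᵥ (w ∘ Sum.inl)) (w ∘ Sum.inr)]

/-! ### Dissipativity of the system and the equivalence -/

theorem locallyControlledSystem_f_eq_zero_iff {n p : ℕ} {A : Matrix (Fin n) (Fin n) ℝ}
    {B : Matrix (Fin n) (Fin p) ℝ} {L : Matrix (Fin p) (Fin n) ℝ} {x u : Fin n → ℝ} :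
    (locallyControlledSystem A B L).f x u = 0 ↔ u = -((A + B * L) *ᵥ x) := by
  change (A + B * L) *ᵥ x + u = 0 ↔ _
  rw [add_comm, add_eq_zero_iff_eq_neg]

theorem fderiv_quadratic_apply {n : ℕ} {Q : Matrix (Fin n) (Fin n) ℝ} (hQ : Qᵀ = Q)
    (xs x h : Fin n → ℝ) :
    fderiv ℝ (fun z => (z - xs) ⬝ᵥ (Q *ᵥ (z - xs))) x h = 2 * ((x - xs) ⬝ᵥ (Q *ᵥ h)) := by
  have h1 : ∀ i, HasFDerivAt (fun z : Fin n → ℝ => (z - xs) i)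
      (ContinuousLinearMap.proj (R := ℝ) (φ := fun _ : Fin n => ℝ) i) x := fun i =>
    (ContinuousLinearMap.proj (R := ℝ) (φ := fun _ : Fin n => ℝ) i).hasFDerivAt.sub_const (xs i)
  have h2 : ∀ i, HasFDerivAt (fun z : Fin n → ℝ => (Q *ᵥ (z - xs)) i)
      ((ContinuousLinearMap.proj (R := ℝ) (φ := fun _ : Fin n => ℝ) i).comp
        Q.mulVecLin.toContinuousLinearMap) x := fun i =>
    (((ContinuousLinearMap.proj (R := ℝ) (φ := fun _ : Fin n => ℝ) i).comp
        Q.mulVecLin.toContinuousLinearMap).hasFDerivAt).comp x ((hasFDerivAt_id x).sub_const xs)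
  have h3 := HasFDerivAt.fun_sum (u := Finset.univ) fun i _ => (h1 i).mul (h2 i)
  have h4 := congrArg (· h) h3.fderiv
  refine h4.trans ?_
  simp only [_root_.sum_apply, _root_.add_apply,
    _root_.smul_apply, ContinuousLinearMap.comp_apply, ContinuousLinearMap.proj_apply,
    smul_eq_mul, Finset.sum_add_distrib, two_mul]
  congr 1
  rw [dotProduct_mulVec_comm_of_transpose_eq hQ, dotProduct]
  exact Finset.sum_congr rfl fun i _ => mul_comm _ _

theorem isXEID_of_quadratic {n p : ℕ} {A : Matrix (Fin n) (Fin n) ℝ}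
    {B : Matrix (Fin n) (Fin p) ℝ} {L : Matrix (Fin p) (Fin n) ℝ}
    {X : Matrix (Fin n ⊕ Fin n) (Fin n ⊕ Fin n) ℝ} (𝒳 : Set (Fin n → ℝ))
    {Q : Matrix (Fin n) (Fin n) ℝ} (hQ : Q.PosDef)
    (hd : ∀ z v, 2 * (z ⬝ᵥ (Q *ᵥ ((A + B * L) *ᵥ z + v))) ≤ quadraticSupply X v z) :
    (locallyControlledSystem A B L).IsXEID 𝒳 X := by
  refine ⟨fun xs _ => ⟨-((A + B * L) *ᵥ xs), locallyControlledSystem_f_eq_zero_iff.2 rfl,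
    fun u hu => locallyControlledSystem_f_eq_zero_iff.1 hu⟩,
    fun w => (w.1 - w.2) ⬝ᵥ (Q *ᵥ (w.1 - w.2)), ?_, ?_, ?_, ?_⟩
  · refine ContDiff.contDiffOn ?_
    have h1 : ContDiff ℝ 1 fun w : (Fin n → ℝ) × (Fin n → ℝ) => w.1 - w.2 :=
      contDiff_fst.sub contDiff_snd
    have h2 : ContDiff ℝ 1 fun w : (Fin n → ℝ) × (Fin n → ℝ) => Q *ᵥ (w.1 - w.2) :=
      Q.mulVecLin.toContinuousLinearMap.contDiff.comp h1
    exact ContDiff.sum fun i _ => (contDiff_pi.1 h1 i).mul (contDiff_pi.1 h2 i)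
  · intro x xs _ hne
    simpa using hQ.dotProduct_mulVec_pos (sub_ne_zero.2 hne)
  · intro xs _
    simp
  · intro x xs _ u us hus
    rw [locallyControlledSystem_f_eq_zero_iff] at hus
    refine (fderiv_quadratic_apply hQ.isHermitian xs x _).trans_le ?_
    have h : (locallyControlledSystem A B L).f x u =
        (A + B * L) *ᵥ (x - xs) + (u - us) := by
      change (A + B * L) *ᵥ x + u = _
      rw [hus, mulVec_sub]
      abel
    rw [h]
    exact hd _ _

theorem exists_quadratic_of_isXEID {n p : ℕ} {A : Matrix (Fin n) (Fin n) ℝ}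
    {B : Matrix (Fin n) (Fin p) ℝ} {L : Matrix (Fin p) (Fin n) ℝ}
    {X : Matrix (Fin n ⊕ Fin n) (Fin n ⊕ Fin n) ℝ} (hX22 : (-X.toBlocks₂₂).PosDef)
    {𝒳 : Set (Fin n → ℝ)} (h𝒳 : 𝒳.Nonempty) (h : (locallyControlledSystem A B L).IsXEID 𝒳 X) :
    ∃ Q : Matrix (Fin n) (Fin n) ℝ, Q.PosDef ∧
      ∀ z v, 2 * (z ⬝ᵥ (Q *ᵥ ((A + B * L) *ᵥ z + v))) ≤ quadraticSupply X v z := by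
  obtain ⟨xs, hxs⟩ := h𝒳
  obtain ⟨-, V, hV, hpos, hzero, hdiss⟩ := h
  have hVd : Differentiable ℝ fun z => V (z, xs) := by
    have h1 : ContDiffOn ℝ 1 (fun z : Fin n → ℝ => V (z, xs)) Set.univ :=
      hV.comp (f := fun z : Fin n → ℝ => (z, xs))
        (contDiff_id.prodMk contDiff_const).contDiffOn fun z _ => ⟨trivial, hxs⟩
    exact (contDiffOn_univ.1 h1).differentiable one_ne_zero
  let f : (Fin n → ℝ) → ℝ := fun z => V (z + xs, xs)
  have hf : Differentiable ℝ f := hVd.comp (differentiable_id.add_const xs)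
  have hf0 : ∀ z, 0 ≤ f z := fun z => by
    rcases eq_or_ne (z + xs) xs with h | h
    · simp only [f, h, hzero xs hxs, le_refl]
    · exact (hpos _ xs hxs h).le
  have hd : ∀ z v, fderiv ℝ f z ((A + B * L) *ᵥ z + v) ≤ quadraticSupply X v z := fun z v => by
    have h := hdiss (z + xs) xs hxs (v - (A + B * L) *ᵥ xs) (-((A + B * L) *ᵥ xs))
      (locallyControlledSystem_f_eq_zero_iff.2 rfl)
    have e1 : (locallyControlledSystem A B L).f (z + xs) (v - (A + B * L) *ᵥ xs) =
        (A + B * L) *ᵥ z + v := by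
      change (A + B * L) *ᵥ (z + xs) + (v - (A + B * L) *ᵥ xs) = _
      rw [mulVec_add]
      abel
    have e2 : (locallyControlledSystem A B L).h (z + xs) (v - (A + B * L) *ᵥ xs) -
        (locallyControlledSystem A B L).h xs (-((A + B * L) *ᵥ xs)) = z := add_sub_cancel_right z xs
    have e3 : fderiv ℝ f z = fderiv ℝ (fun z => V (z, xs)) (z + xs) :=
      fderiv_comp_add_right (f := fun z => V (z, xs)) xs
    rw [e1, e2, sub_neg_eq_add, sub_add_cancel] at h
    rwa [e3]
  -- The storage is minimal at the origin, so its derivative vanishes there.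
  have hX11 : ∀ v, 0 ≤ quadraticSupply X v 0 := fun v => by
    have hmin : IsLocalMin f 0 := Filter.Eventually.of_forall fun z => by
      have : f 0 = 0 := by simp only [f, zero_add, hzero xs hxs]
      exact this ▸ hf0 z
    simpa [hmin.fderiv_eq_zero] using hd 0 v
  obtain ⟨Q, hQ, hQd⟩ := exists_quadratic_storage hf hf0 hd hX11
  exact ⟨Q, posDef_of_dissipative hf hf0 hX22 hd hQ hQd, hQd⟩

theorem corollary1 {n p : ℕ} (A : Matrix (Fin n) (Fin n) ℝ) (B : Matrix (Fin n) (Fin p) ℝ)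
    (L : Matrix (Fin p) (Fin n) ℝ)
    (X : Matrix (Fin n ⊕ Fin n) (Fin n ⊕ Fin n) ℝ) (hX : X.IsSymm)
    (hX22 : (-X.toBlocks₂₂).PosDef)
    (𝒳 : Set (Fin n → ℝ)) (h𝒳 : 𝒳.Nonempty) :
    (locallyControlledSystem A B L).IsXEID 𝒳 X ↔
      ∃ (P : Matrix (Fin n) (Fin n) ℝ) (K : Matrix (Fin p) (Fin n) ℝ),
        P.PosDef ∧ (synthesisMatrix A B X P K).PosSemidef ∧ L = K * P⁻¹ := by
  constructor
  · intro h
    obtain ⟨Q, hQ, hQd⟩ := exists_quadratic_of_isXEID hX22 h𝒳 h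
    have hdet := (isUnit_iff_isUnit_det Q).1 hQ.isUnit
    have hL : L = L * Q⁻¹ * Q⁻¹⁻¹ := by
      rw [nonsing_inv_nonsing_inv _ hdet, nonsing_inv_mul_cancel_right _ _ hdet]
    refine ⟨Q⁻¹, L * Q⁻¹, hQ.inv, (synthesisMatrix_posSemidef_iff hX hX22 hQ.inv _).2 ?_, hL⟩
    rw [← hL, nonsing_inv_nonsing_inv _ hdet]
    exact hQd
  · rintro ⟨P, K, hP, hS, rfl⟩
    exact isXEID_of_quadratic 𝒳 hP.inv ((synthesisMatrix_posSemidef_iff hX hX22 hP K).1 hS)
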